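/- All complexes are finite abstract simplicial complexes; the empty set counts as a face, of dimension $-1$. $S_i(K)$ is the set of $i$-faces of $K$ (faces with $i+1$ vertices), and $F\in\partial \bar F$ means that $F$ arises from $\bar F$ by removing one vertex. $C^i(K,\mathbb R)$ is the space of real $i$-cochains, i.e. functions $f$ on oriented $i$-faces that change sign under reversal of the orientation, and $\delta_{i}:C^{i}(K,\mathbb R)\to C^{i+1}(K,\mathbb R)$ is the (augmented) coboundary map $(\delta_{i}f)([v_0,\dots,v_{i+1}])=\sum_{j}(-1)^jf([v_0,\dots,\hat v_j,\dots,v_{i+1}])$. For a positive weight $w$ on the faces of $K$, give $C^i(K,\mathbb R)$ the inner product $\langle f,g\rangle=\sum_{F\in S_i(K)}w(F)f([F])g([F])$; the $i$-down Laplace operator is $\delta_{i-1}\delta_{i-1}^*$ on $C^i(K,\mathbb R)$. For $w\equiv 1$ it is the combinatorial $i$-down Laplace operator $L_i^{\mathrm{down}}(K)$. If $w(F)=1$ for facets (maximal faces) $F$ and $w(F)=\sum_{\bar F:\,F\in\partial\bar F}w(\bar F)$ for all other faces, it is the normalized $i$-down Laplace operator $\Delta_i^{\mathrm{down}}(K)$.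 A covering map $\phi:K\to M$ is a simplicial map, with $K$ connected, such that for every face $G$ of $M$ the preimage $\phi^{-1}(G)$ (the subcomplex of the faces of $K$ mapped into $G$) is a union of pairwise disjoint simplices, each mapped bijectively onto $G$ by $\phi$. It is strong if, whenever $G\in\partial\bar G$ in $M$ and $F$ is a face of $K$ with $\phi(F)=G$, there is a face $\bar F$ of $K$ with $F\in\partial\bar F$ and $\phi(\bar F)=\bar G$. A strong covering is $k$-fold ($k\ge 1$) if every nonempty face of $M$ is the image of exactly $k$ faces of $K$. **Theorem.** Let $\phi:K\to M$ be a $k$-fold (strong) covering. Then, as multisets (eigenvalues counted with multiplicity), $$\operatorname{Spec}L_i^{\mathrm{down}}(M)\subset\operatorname{Spec}L_i^{\mathrm{down}}(K)\quad\text{for all } i\ge 1,\qquad \operatorname{Spec}\Delta_i^{\mathrm{down}}(M)\subset\operatorname{Spec}\Delta_i^{\mathrm{down}}(K)\quad\text{for all } i\ge 0 .$$ -/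

import Mathlib

/-! Finite abstract simplicial complexes are Mathlib's `AbstractSimplicialComplex V` with `V` finite;
`V` is the vertex set.  Mathlib's complexes list the nonempty faces only; the empty simplex is added
by `IsFace`.  Faces, cochains etc. are indexed by the number `n` of vertices, that is, by
`n = i + 1` for dimension `i ≥ -1`. -/

namespace AbstractSimplicialComplex

noncomputable section

/-- The faces of `K`, including the empty simplex. -/
def IsFace {V : Type*} (K : AbstractSimplicialComplex V) (F : Finset V) : Prop :=
  F = ∅ ∨ F ∈ K

theorem IsFace.mono {V : Type*} {K : AbstractSimplicialComplex V} {F G : Finset V}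
    (hG : K.IsFace G) (h : F ⊆ G) : K.IsFace F := by
  rcases F.eq_empty_or_nonempty with rfl | hF
  · exact Or.inl rfl
  · rcases hG with rfl | hG
    · exact Or.inl (Finset.subset_empty.mp h)
    · exact Or.inr ((K.isRelLowerSet_faces hG).2 h hF)

/-- `F ∈ ∂G`: the set `F` arises from `G` by removing one vertex. -/
def InBoundary {V : Type*} (F G : Finset V) : Prop :=
  F ⊆ G ∧ G.card = F.card + 1

/-- The faces with `n` vertices, i.e. the `(n - 1)`-faces. -/
def Face {V : Type*} (K : AbstractSimplicialComplex V) (n : ℕ) : Type _ :=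
  {F : Finset V // K.IsFace F ∧ F.card = n}

instance {V : Type*} [Finite V] (K : AbstractSimplicialComplex V) (n : ℕ) :
    Finite (K.Face n) :=
  inferInstanceAs (Finite {F : Finset V // K.IsFace F ∧ F.card = n})

instance {V : Type*} [Finite V] (K : AbstractSimplicialComplex V) (n : ℕ) :
    Fintype (K.Face n) :=
  Fintype.ofFinite _

/-! ### Cochains -/

/-- Faces with `n` vertices together with an ordering `v 0, …, v (n - 1)` of their vertices. -/
def OrderedFace {V : Type*} (K : AbstractSimplicialComplex V) (n : ℕ) : Type _ :=
  {v : Fin n ↪ V // K.IsFace (Finset.univ.map v)}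

instance {V : Type*} [Finite V] (K : AbstractSimplicialComplex V) (n : ℕ) :
    Finite (K.OrderedFace n) :=
  inferInstanceAs (Finite {v : Fin n ↪ V // K.IsFace (Finset.univ.map v)})

/-- The same face with its vertices reordered by `σ`. -/
def OrderedFace.perm {V : Type*} {K : AbstractSimplicialComplex V} {n : ℕ}
    (v : K.OrderedFace n) (σ : Equiv.Perm (Fin n)) : K.OrderedFace n :=
  ⟨σ.toEmbedding.trans v.1, v.2.mono (by
    intro x hx
    simp only [Finset.mem_map, Finset.mem_univ, true_and] at hx ⊢
    obtain ⟨a, rfl⟩ := hx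
    exact ⟨σ a, rfl⟩)⟩

/-- The ordered face `[v₀, …, v̂ⱼ, …, vₙ]`. -/
def OrderedFace.dropVertex {V : Type*} {K : AbstractSimplicialComplex V} {n : ℕ}
    (v : K.OrderedFace (n + 1)) (j : Fin (n + 1)) : K.OrderedFace n :=
  ⟨(Fin.succAboveEmb j).trans v.1, v.2.mono (by
    intro x hx
    simp only [Finset.mem_map, Finset.mem_univ, true_and] at hx ⊢
    obtain ⟨a, rfl⟩ := hx
    exact ⟨j.succAbove a, rfl⟩)⟩

/-- A chosen ordering of the vertices of a face. -/
def Face.ordering {V : Type*} {K : AbstractSimplicialComplex V} {n : ℕ} (F : K.Face n) :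
    K.OrderedFace n :=
  ⟨(F.1.equivFinOfCardEq F.2.2).symm.toEmbedding.trans (Function.Embedding.subtype _),
    F.2.1.mono (by
      intro x hx
      simp only [Finset.mem_map, Finset.mem_univ, true_and] at hx
      obtain ⟨a, rfl⟩ := hx
      exact ((F.1.equivFinOfCardEq F.2.2).symm a).2)⟩

/-- Real cochains on the faces with `n` vertices, i.e. the linear dual of the space generated by
the oriented faces modulo `[F₁] + [F₂] = 0` for opposite orientations of one face: functions on
ordered faces that change by the sign of the permutation when the vertices are reordered. -/
def Cochain {V : Type*} (K : AbstractSimplicialComplex V) (n : ℕ) :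
    Submodule ℝ (K.OrderedFace n → ℝ) where
  carrier := {f | ∀ (v : K.OrderedFace n) (σ : Equiv.Perm (Fin n)),
    f (v.perm σ) = ((Equiv.Perm.sign σ : ℤ) : ℝ) * f v}
  add_mem' := by
    intro f g hf hg v σ
    simp only [Pi.add_apply, hf v σ, hg v σ]
    ring
  zero_mem' := by
    intro v σ
    simp
  smul_mem' := by
    intro c f hf v σ
    simp only [Pi.smul_apply, smul_eq_mul, hf v σ]
    ring

theorem exists_perm_dropVertex {V : Type*} {K : AbstractSimplicialComplex V} {n : ℕ}
    (v : K.OrderedFace (n + 1)) (σ : Equiv.Perm (Fin (n + 1))) (j : Fin (n + 1)) :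
    ∃ τ : Equiv.Perm (Fin n), (v.perm σ).dropVertex j = (v.dropVertex (σ j)).perm τ ∧
      (-1 : ℝ) ^ (j : ℕ) * ((Equiv.Perm.sign τ : ℤ) : ℝ) =
        ((Equiv.Perm.sign σ : ℤ) : ℝ) * (-1 : ℝ) ^ ((σ j : Fin (n + 1)) : ℕ) := by
  set ρ : Equiv.Perm (Fin (n + 1)) := (σ j).cycleRange * σ * (j.cycleRange)⁻¹ with hρ
  have h0 : ρ 0 = 0 := by
    simp [hρ, Equiv.Perm.mul_apply, Equiv.Perm.inv_def]
  obtain ⟨⟨p, τ⟩, hpτ⟩ := (Equiv.Perm.decomposeFin (n := n)).symm.surjective ρ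
  have hp : p = 0 := by
    have := Equiv.Perm.decomposeFin_symm_apply_zero p τ
    rw [hpτ, h0] at this
    exact this.symm
  subst hp
  refine ⟨τ, ?_, ?_⟩
  · apply Subtype.ext
    ext k
    change v.1 (σ (j.succAbove k)) = v.1 ((σ j).succAbove (τ k))
    congr 1
    have h1 : ρ k.succ = (τ k).succ := by
      rw [← hpτ]
      simp
    apply (σ j).cycleRange.injective
    rw [Fin.cycleRange_succAbove, ← h1]
    simp [hρ, Equiv.Perm.mul_apply, Equiv.Perm.inv_def]
  · have h2 : Equiv.Perm.sign ρ = Equiv.Perm.sign τ := by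
      rw [← hpτ]
      simp
    have h3 : Equiv.Perm.sign τ =
        (-1) ^ ((σ j : Fin (n + 1)) : ℕ) * Equiv.Perm.sign σ * (-1) ^ (j : ℕ) := by
      rw [← h2, hρ]
      simp [Fin.sign_cycleRange]
    rw [h3]
    push_cast
    have h4 : (-1 : ℝ) ^ (j : ℕ) * (-1 : ℝ) ^ (j : ℕ) = 1 := by
      rw [← mul_pow]; simp
    linear_combination ((-1 : ℝ) ^ ((σ j : Fin (n + 1)) : ℕ) *
      ((Equiv.Perm.sign σ : ℤ) : ℝ)) * h4

/-- The coboundary `(δ f)([v₀, …, vₙ]) = ∑ⱼ (-1)ʲ f([v₀, …, v̂ⱼ, …, vₙ])`. -/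
def coboundary {V : Type*} (K : AbstractSimplicialComplex V) (n : ℕ) :
    K.Cochain n →ₗ[ℝ] K.Cochain (n + 1) where
  toFun f := ⟨fun v => ∑ j : Fin (n + 1), (-1 : ℝ) ^ (j : ℕ) * f.1 (v.dropVertex j), by
    intro v σ
    rw [Finset.mul_sum, ← Equiv.sum_comp σ]
    refine Finset.sum_congr rfl fun j _ => ?_
    obtain ⟨τ, h1, h2⟩ := exists_perm_dropVertex v σ j
    rw [h1, f.2 _ τ, ← mul_assoc, h2, mul_assoc]⟩
  map_add' f g := by
    apply Subtype.ext
    funext v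
    simp [mul_add, Finset.sum_add_distrib]
  map_smul' c f := by
    apply Subtype.ext
    funext v
    simp only [SetLike.val_smul, Pi.smul_apply, smul_eq_mul, RingHom.id_apply, Finset.mul_sum]
    exact Finset.sum_congr rfl fun j _ => by ring

/-! ### Weights, inner products and Laplace operators -/

/-- A weight function: it is positive on all faces, including the empty one. -/
structure FaceWeight {V : Type*} (K : AbstractSimplicialComplex V) where
  toFun : Finset V → ℝ
  pos : ∀ F, K.IsFace F → 0 < toFun F

theorem exists_ordering_perm {V : Type*} {K : AbstractSimplicialComplex V} {n : ℕ}
    (v : K.OrderedFace n) :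
    ∃ (F : K.Face n) (σ : Equiv.Perm (Fin n)), v = F.ordering.perm σ := by
  let F : K.Face n := ⟨Finset.univ.map v.1, v.2, by simp⟩
  let e := F.1.equivFinOfCardEq F.2.2
  have hmem : ∀ a, v.1 a ∈ F.1 := fun a => Finset.mem_map_of_mem _ (Finset.mem_univ a)
  let s : Fin n → Fin n := fun a => e ⟨v.1 a, hmem a⟩
  have hs : Function.Injective s := fun a b h => by
    have := e.injective h
    exact v.1.injective (congrArg Subtype.val this)
  refine ⟨F, Equiv.ofBijective s (Finite.injective_iff_bijective.mp hs), ?_⟩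
  apply Subtype.ext
  ext a
  change v.1 a = (e.symm (e ⟨v.1 a, hmem a⟩)).1
  simp

/-- The cochain space of `K`, to be equipped with the inner product given by the weight `w`. -/
def WCochain {V : Type*} {K : AbstractSimplicialComplex V} (_w : K.FaceWeight) (n : ℕ) : Type _ :=
  K.Cochain n

instance {V : Type*} {K : AbstractSimplicialComplex V} (w : K.FaceWeight) (n : ℕ) :
    AddCommGroup (WCochain w n) :=
  inferInstanceAs (AddCommGroup (K.Cochain n))

instance {V : Type*} {K : AbstractSimplicialComplex V} (w : K.FaceWeight) (n : ℕ) :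
    Module ℝ (WCochain w n) :=
  inferInstanceAs (Module ℝ (K.Cochain n))

instance {V : Type*} [Finite V] {K : AbstractSimplicialComplex V} (w : K.FaceWeight) (n : ℕ) :
    FiniteDimensional ℝ (WCochain w n) :=
  inferInstanceAs (FiniteDimensional ℝ (K.Cochain n))

/-- The inner product `⟪f, g⟫ = ∑_F w(F) f([F]) g([F])`, the sum over all faces with `n` vertices;
the terms do not depend on the chosen orientations. -/
abbrev innerCore {V : Type*} [Finite V] {K : AbstractSimplicialComplex V}
    (w : K.FaceWeight) (n : ℕ) : InnerProductSpace.Core ℝ (WCochain w n) where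
  inner f g := ∑ F : K.Face n, w.toFun F.1 * f.1 F.ordering * g.1 F.ordering
  conj_inner_symm f g := by
    simp only [conj_trivial]
    exact Finset.sum_congr rfl fun F _ => by ring
  re_inner_nonneg f := by
    simp only [RCLike.re_to_real]
    refine Finset.sum_nonneg fun F _ => ?_
    rw [mul_assoc]
    exact mul_nonneg (w.pos _ F.2.1).le (mul_self_nonneg _)
  add_left f g h := by
    rw [← Finset.sum_add_distrib]
    refine Finset.sum_congr rfl fun F _ => ?_
    change w.toFun F.1 * (f.1 F.ordering + g.1 F.ordering) * h.1 F.ordering = _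
    ring
  smul_left f g r := by
    simp only [conj_trivial]
    rw [Finset.mul_sum]
    refine Finset.sum_congr rfl fun F _ => ?_
    change w.toFun F.1 * (r * f.1 F.ordering) * g.1 F.ordering = _
    ring
  definite f hf := by
    have hz : ∀ F : K.Face n, f.1 F.ordering = 0 := by
      intro F
      have hnn : ∀ G ∈ (Finset.univ : Finset (K.Face n)),
          0 ≤ w.toFun G.1 * f.1 G.ordering * f.1 G.ordering := fun G _ => by
        rw [mul_assoc]
        exact mul_nonneg (w.pos _ G.2.1).le (mul_self_nonneg _)
      have h := (Finset.sum_eq_zero_iff_of_nonneg hnn).mp hf F (Finset.mem_univ F)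
      rw [mul_assoc] at h
      rcases mul_eq_zero.mp h with h | h
      · exact absurd h (w.pos _ F.2.1).ne'
      · exact mul_self_eq_zero.mp h
    apply Subtype.ext
    funext v
    obtain ⟨F, σ, rfl⟩ := exists_ordering_perm v
    rw [f.2 F.ordering σ, hz F, mul_zero]
    rfl

instance {V : Type*} [Finite V] {K : AbstractSimplicialComplex V} (w : K.FaceWeight) (n : ℕ) :
    NormedAddCommGroup (WCochain w n) :=
  (innerCore w n).toNormedAddCommGroup

instance {V : Type*} [Finite V] {K : AbstractSimplicialComplex V} (w : K.FaceWeight) (n : ℕ) :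
    InnerProductSpace ℝ (WCochain w n) :=
  InnerProductSpace.ofCore (innerCore w n).toCore

/-- The coboundary as a map of weighted cochain spaces. -/
def wCoboundary {V : Type*} [Finite V] {K : AbstractSimplicialComplex V} (w : K.FaceWeight)
    (n : ℕ) : WCochain w n →ₗ[ℝ] WCochain w (n + 1) :=
  K.coboundary n

/-- The `i`-down Laplace operator `δᵢ₋₁ δᵢ₋₁*` on the `i`-cochains (`i ≥ 0`), with respect to the
weight `w`. -/
def downLaplacian {V : Type*} [Finite V] {K : AbstractSimplicialComplex V} (w : K.FaceWeight)
    (i : ℕ) : WCochain w (i + 1) →ₗ[ℝ] WCochain w (i + 1) :=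
  wCoboundary w i ∘ₗ LinearMap.adjoint (wCoboundary w i)

/-- The weight that is identically `1`. -/
def unitWeight {V : Type*} (K : AbstractSimplicialComplex V) : K.FaceWeight where
  toFun _ := 1
  pos _ _ := one_pos

open Classical in
/-- The normalized weight: `w(F) = 1` if `F` is a facet (a maximal face), and otherwise `w(F)` is
the sum of `w(G)` over all faces `G` with `F ∈ ∂G`. -/
def normalizedWeightFun {V : Type*} [Fintype V] (K : AbstractSimplicialComplex V)
    (F : Finset V) : ℝ :=
  if Maximal K.IsFace F then 1
  else ∑ G ∈ (Finset.univ.filter fun G => K.IsFace G ∧ InBoundary F G).attach,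
    normalizedWeightFun K G.1
termination_by Fintype.card V - F.card
decreasing_by
  have h := (Finset.mem_filter.mp G.2).2.2.2
  have h' := Finset.card_le_univ G.1
  omega

theorem normalizedWeightFun_pos {V : Type*} [Fintype V] (K : AbstractSimplicialComplex V)
    (F : Finset V) (hF : K.IsFace F) : 0 < normalizedWeightFun K F := by
  classical
  induction hm : Fintype.card V - F.card using Nat.strong_induction_on generalizing F with
  | _ m ih =>
    rw [normalizedWeightFun]
    split_ifs with h
    · exact one_pos
    · refine Finset.sum_pos (fun G _ => ?_) ?_
      · have hG := (Finset.mem_filter.mp G.2).2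
        have h1 := hG.2.2
        have h2 := Finset.card_le_univ G.1
        exact ih _ (by omega) G.1 hG.1 rfl
      · rw [Finset.attach_nonempty_iff]
        rw [not_maximal_iff hF] at h
        obtain ⟨G, hG, hlt⟩ := h
        obtain ⟨x, hxG, hxF⟩ := Finset.exists_of_ssubset hlt
        refine ⟨insert x F, Finset.mem_filter.mpr ⟨Finset.mem_univ _, hG.mono ?_,
          Finset.subset_insert _ _, Finset.card_insert_of_notMem hxF⟩⟩
        exact Finset.insert_subset hxG hlt.1

def normalizedWeight {V : Type*} [Fintype V] (K : AbstractSimplicialComplex V) :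
    K.FaceWeight where
  toFun := normalizedWeightFun K
  pos := normalizedWeightFun_pos K

/-- The combinatorial `i`-down Laplace operator. -/
def combDownLaplacian {V : Type*} [Finite V] (K : AbstractSimplicialComplex V) (i : ℕ) :
    WCochain (unitWeight K) (i + 1) →ₗ[ℝ] WCochain (unitWeight K) (i + 1) :=
  downLaplacian (unitWeight K) i

/-- The normalized `i`-down Laplace operator. -/
def normDownLaplacian {V : Type*} [Fintype V] (K : AbstractSimplicialComplex V) (i : ℕ) :
    WCochain (normalizedWeight K) (i + 1) →ₗ[ℝ] WCochain (normalizedWeight K) (i + 1) :=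
  downLaplacian (normalizedWeight K) i

/-- The spectrum of a linear operator on a finite-dimensional real space, as a multiset: all complex
roots of the characteristic polynomial, with multiplicities. -/
def multisetSpectrum {E : Type*} [AddCommGroup E] [Module ℝ E] [FiniteDimensional ℝ E]
    (T : E →ₗ[ℝ] E) : Multiset ℂ :=
  T.charpoly.aroots ℂ

/-! ### Coverings -/

/-- The graph of vertices and edges. -/
def oneSkeleton {V : Type*} [DecidableEq V] (K : AbstractSimplicialComplex V) :
    SimpleGraph V where
  Adj u v := u ≠ v ∧ ({u, v} : Finset V) ∈ K
  symm := ⟨fun u v h => ⟨h.1.symm, by rw [Finset.pair_comm]; exact h.2⟩⟩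
  loopless := ⟨fun _ h => h.1 rfl⟩

/-- Connected: any two vertices are joined by a path of edges. -/
def IsConnected {V : Type*} [DecidableEq V] (K : AbstractSimplicialComplex V) : Prop :=
  K.oneSkeleton.Preconnected

/-- Simplicial maps, given on vertices. -/
def IsSimplicialMap {V W : Type*} [DecidableEq W] (K : AbstractSimplicialComplex V)
    (M : AbstractSimplicialComplex W) (φ : V → W) : Prop :=
  ∀ F, K.IsFace F → M.IsFace (F.image φ)

/-- The faces of `K` lying over the face `G` of the base. -/
def facesOver {V W : Type*} [DecidableEq W] (K : AbstractSimplicialComplex V) (φ : V → W)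
    (G : Finset W) : Set (Finset V) :=
  {F | K.IsFace F ∧ F.image φ = G}

/-- Covering maps.  In `preimage`, `φ⁻¹(G)` is the subcomplex of all faces of `K` that `φ` maps into
`G`; it is the union of the pairwise disjoint full simplices `F ∈ 𝓕`. -/
structure IsCoveringMap {V W : Type*} [DecidableEq V] [DecidableEq W]
    (K : AbstractSimplicialComplex V) (M : AbstractSimplicialComplex W) (φ : V → W) : Prop where
  connected : K.IsConnected
  simplicial : IsSimplicialMap K M φ
  preimage : ∀ G, M.IsFace G → ∃ 𝓕 : Set (Finset V),
    𝓕.PairwiseDisjoint id ∧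
    (∀ F ∈ 𝓕, K.IsFace F ∧ Set.BijOn φ F G) ∧
    ∀ F ∈ K, F.image φ ⊆ G ↔ ∃ F' ∈ 𝓕, F ⊆ F'

/-- Strong coverings: every face over `G ∈ ∂G'` lies in the boundary of a face over `G'`. -/
structure IsStrongCovering {V W : Type*} [DecidableEq V] [DecidableEq W]
    (K : AbstractSimplicialComplex V) (M : AbstractSimplicialComplex W) (φ : V → W) : Prop
    extends IsCoveringMap K M φ where
  lift : ∀ G G', M.IsFace G → M.IsFace G' → InBoundary G G' →
    ∀ F ∈ facesOver K φ G, ∃ F' ∈ facesOver K φ G', InBoundary F F'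

/-- `k`-fold coverings: strong coverings with exactly `k ≥ 1` faces over each nonempty face of the
base. -/
structure IsKFoldCovering {V W : Type*} [DecidableEq V] [DecidableEq W]
    (K : AbstractSimplicialComplex V) (M : AbstractSimplicialComplex W) (φ : V → W) (k : ℕ) : Prop
    extends IsStrongCovering K M φ where
  pos : 0 < k
  degree : ∀ G ∈ M, (facesOver K φ G).ncard = k

end

end AbstractSimplicialComplex

/-! Pulling cochains back along `φ` embeds the cochains of `M` injectively into those of `K`. If the
pullback `φ*` intertwines the down Laplacians, its image is an invariant subspace of the Laplacian
of `K` on which that operator acts as the Laplacian of `M`, so one characteristic polynomial divides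
the other (`multisetSpectrum_le_of_intertwine`).

The pullback commutes with `δ` on the nose, so only `δ* φ* = φ* δ*` needs proof. When the weights
are compatible, the adjoint of `φ*` is the pushforward, the sum over all lifts (`inner_pullback`),
and the claim becomes that the pushforward commutes with `δ`. This holds because deleting a vertex
is a bijection from the lifts of an ordered face to the lifts of its boundary face: two faces over
the same face that share a vertex agree, and strongness makes every lift extend
(`IsStrongCovering.sum_lifts_dropVertex`). The same bijection shows that `φ` preserves the
normalized weights of nonempty faces.

The empty face is exceptional: it has one lift, while a vertex has `k`. In degree `i = 0` this
produces a factor `k`, which the normalized weight of `∅` absorbs, being `k` times as large on `K`.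
Unit weights offer no such compensation, hence `i ≥ 1` in the combinatorial case. -/

/-- If an injective linear map intertwines `B` with `A`, then the characteristic polynomial of `B`
divides that of `A`. -/
theorem LinearMap.charpoly_dvd_of_injective_of_comp_eq {𝕜 E U : Type*} [Field 𝕜]
    [AddCommGroup E] [Module 𝕜 E] [FiniteDimensional 𝕜 E]
    [AddCommGroup U] [Module 𝕜 U] [FiniteDimensional 𝕜 U]
    (A : U →ₗ[𝕜] U) (B : E →ₗ[𝕜] E) (J : E →ₗ[𝕜] U) (hJ : Function.Injective J)
    (h : A ∘ₗ J = J ∘ₗ B) : B.charpoly ∣ A.charpoly := by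
  classical
  obtain ⟨q, hq⟩ := Submodule.exists_isCompl (LinearMap.range J)
  let e : (E × q) ≃ₗ[𝕜] U :=
    ((LinearEquiv.ofInjective J hJ).prodCongr (LinearEquiv.refl 𝕜 q)).trans
      (Submodule.prodEquivOfIsCompl _ q hq)
  have he (x : E) : e (x, 0) = J x := by simp [e]
  have hA (x : E) : e.symm.conj A (x, 0) = (B x, 0) := by
    rw [LinearEquiv.conj_apply_apply, LinearEquiv.symm_symm, he, LinearEquiv.symm_apply_eq, he]
    exact LinearMap.congr_fun h x
  rw [← LinearEquiv.charpoly_conj e.symm A]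
  let b := Module.finBasis 𝕜 E
  let b' := Module.finBasis 𝕜 q
  set T := e.symm.conj A
  -- Since `T` maps `E × 0` to itself and acts there as `B`, its matrix is block upper triangular
  -- with the matrix of `B` in the corner.
  have hM : LinearMap.toMatrix (b.prod b') (b.prod b') T =
      Matrix.fromBlocks (LinearMap.toMatrix b b B)
        (LinearMap.toMatrix (b.prod b') (b.prod b') T).toBlocks₁₂ 0
        (LinearMap.toMatrix (b.prod b') (b.prod b') T).toBlocks₂₂ := by
    conv_lhs => rw [← Matrix.fromBlocks_toBlocks (LinearMap.toMatrix (b.prod b') (b.prod b') T)]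
    congr 1 <;> ext i j <;>
      simp [Matrix.toBlocks₁₁, Matrix.toBlocks₂₁, LinearMap.toMatrix_apply, hA]
  rw [← LinearMap.charpoly_toMatrix T (b.prod b'), hM, Matrix.charpoly_fromBlocks_zero₂₁,
    LinearMap.charpoly_toMatrix]
  exact dvd_mul_right _ _

namespace AbstractSimplicialComplex

noncomputable section

theorem multisetSpectrum_le_of_intertwine {E U : Type*}
    [AddCommGroup E] [Module ℝ E] [FiniteDimensional ℝ E]
    [AddCommGroup U] [Module ℝ U] [FiniteDimensional ℝ U]
    (A : U →ₗ[ℝ] U) (B : E →ₗ[ℝ] E) (J : E →ₗ[ℝ] U) (hJ : Function.Injective J)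
    (h : A ∘ₗ J = J ∘ₗ B) : multisetSpectrum B ≤ multisetSpectrum A :=
  Polynomial.roots.le_of_dvd (A.charpoly_monic.map _).ne_zero
    (Polynomial.map_dvd _ (LinearMap.charpoly_dvd_of_injective_of_comp_eq A B J hJ h))

/-! ### Ordered faces -/

instance {V : Type*} [Finite V] (K : AbstractSimplicialComplex V) (n : ℕ) :
    Fintype (K.OrderedFace n) :=
  Fintype.ofFinite _

section OrderedFace

variable {V : Type*} {K : AbstractSimplicialComplex V} {n : ℕ}

/-- The set of vertices of an ordered face. -/
def OrderedFace.vertices (v : K.OrderedFace n) : Finset V :=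
  Finset.univ.map v.1

theorem OrderedFace.isFace_vertices (v : K.OrderedFace n) : K.IsFace v.vertices := v.2

theorem OrderedFace.card_vertices (v : K.OrderedFace n) : v.vertices.card = n := by
  simp [OrderedFace.vertices]

theorem OrderedFace.mem_vertices {v : K.OrderedFace n} {x : V} :
    x ∈ v.vertices ↔ ∃ a, v.1 a = x := by
  simp [OrderedFace.vertices]

theorem OrderedFace.apply_mem_vertices (v : K.OrderedFace n) (a : Fin n) : v.1 a ∈ v.vertices :=
  OrderedFace.mem_vertices.mpr ⟨a, rfl⟩

@[ext]
theorem OrderedFace.ext {u v : K.OrderedFace n} (h : ∀ a, u.1 a = v.1 a) : u = v :=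
  Subtype.ext (DFunLike.ext _ _ h)

theorem OrderedFace.vertices_perm (v : K.OrderedFace n) (σ : Equiv.Perm (Fin n)) :
    (v.perm σ).vertices = v.vertices := by
  ext x
  simp only [OrderedFace.mem_vertices]
  exact σ.exists_congr_left.trans (exists_congr fun a => by
    change v.1 (σ (σ.symm a)) = x ↔ _
    rw [σ.apply_symm_apply])

theorem OrderedFace.inBoundary_dropVertex (v : K.OrderedFace (n + 1)) (j : Fin (n + 1)) :
    InBoundary (v.dropVertex j).vertices v.vertices := by
  refine ⟨fun x hx => ?_, by simp only [OrderedFace.card_vertices]⟩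
  obtain ⟨a, rfl⟩ := OrderedFace.mem_vertices.mp hx
  exact v.apply_mem_vertices (j.succAbove a)

theorem Face.vertices_ordering (F : K.Face n) : F.ordering.vertices = F.1 := by
  refine Finset.eq_of_subset_of_card_le (fun x hx => ?_) ?_
  · obtain ⟨a, rfl⟩ := OrderedFace.mem_vertices.mp hx
    exact ((F.1.equivFinOfCardEq F.2.2).symm a).2
  · rw [OrderedFace.card_vertices, F.2.2]

/-- Reordering by a fixed permutation, as a bijection of the ordered faces. -/
def OrderedFace.permEquiv (σ : Equiv.Perm (Fin n)) : K.OrderedFace n ≃ K.OrderedFace n where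
  toFun v := v.perm σ
  invFun v := v.perm σ⁻¹
  left_inv v := OrderedFace.ext fun a => congrArg v.1 (σ.apply_symm_apply a)
  right_inv v := OrderedFace.ext fun a => congrArg v.1 (σ.symm_apply_apply a)

theorem bijective_ordering_perm :
    Function.Bijective fun p : K.Face n × Equiv.Perm (Fin n) => p.1.ordering.perm p.2 := by
  refine ⟨fun ⟨F, σ⟩ ⟨F', σ'⟩ h => ?_, fun v => ?_⟩
  · have hF : F = F' := by
      apply Subtype.ext
      have := congrArg OrderedFace.vertices h
      simpa only [OrderedFace.vertices_perm, Face.vertices_ordering] using this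
    subst hF
    have hσ : σ = σ' := Equiv.ext fun a =>
      F.ordering.1.injective (DFunLike.congr_fun (congrArg Subtype.val h) a)
    rw [hσ]
  · obtain ⟨F, σ, h⟩ := exists_ordering_perm v
    exact ⟨(F, σ), h.symm⟩

/-- Each face has `n!` orderings, and the signs of the two cochains cancel. Summing over all
orderings removes the chosen orientations, which `φ` need not respect. -/
theorem factorial_mul_inner [Finite V] (w : K.FaceWeight) (f g : WCochain w n) :
    (n.factorial : ℝ) * inner ℝ f g =
      ∑ v : K.OrderedFace n, w.toFun v.vertices * f.1 v * g.1 v := by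
  have hin : inner ℝ f g = ∑ F : K.Face n, w.toFun F.1 * f.1 F.ordering * g.1 F.ordering := rfl
  rw [hin, ← bijective_ordering_perm.sum_comp, Fintype.sum_prod_type, Finset.mul_sum]
  refine Finset.sum_congr rfl fun F _ => ?_
  have h (σ : Equiv.Perm (Fin n)) :
      w.toFun (F.ordering.perm σ).vertices * f.1 (F.ordering.perm σ) * g.1 (F.ordering.perm σ) =
        w.toFun F.1 * f.1 F.ordering * g.1 F.ordering := by
    have hs : ((Equiv.Perm.sign σ : ℤ) : ℝ) * ((Equiv.Perm.sign σ : ℤ) : ℝ) = 1 := by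
      rw [← Int.cast_mul, ← Units.val_mul, Int.units_mul_self]; simp
    rw [OrderedFace.vertices_perm, Face.vertices_ordering, f.2 F.ordering σ, g.2 F.ordering σ]
    linear_combination (w.toFun F.1 * f.1 F.ordering * g.1 F.ordering) * hs
  simp [h, Fintype.card_perm]

open Classical in
theorem normalizedWeightFun_of_not_maximal [Fintype V] {F : Finset V}
    (hF : ¬ Maximal K.IsFace F) :
    normalizedWeightFun K F =
      ∑ G ∈ Finset.univ.filter fun G => K.IsFace G ∧ InBoundary F G,
        normalizedWeightFun K G := by
  rw [normalizedWeightFun, if_neg hF]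
  exact Finset.sum_attach _ (normalizedWeightFun K)

theorem inBoundary_empty_iff {F : Finset V} : InBoundary ∅ F ↔ F.card = 1 := by
  simp [InBoundary]

end OrderedFace

/-! ### Faces under a covering map -/

section Covering

variable {V W : Type*} [DecidableEq V] [DecidableEq W]
  {K : AbstractSimplicialComplex V} {M : AbstractSimplicialComplex W} {φ : V → W} {n k : ℕ}

/-- A nonempty face lies in one of the simplices over its own image, and `φ` is bijective on that
simplex. -/
theorem IsCoveringMap.injOn (hφ : IsCoveringMap K M φ) {F : Finset V} (hF : K.IsFace F) :
    Set.InjOn φ F := by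
  obtain ⟨𝓕, -, hbij, hsub⟩ := hφ.preimage _ (hφ.simplicial F hF)
  rcases hF with rfl | hF
  · simp
  · obtain ⟨F', hF', hle⟩ := (hsub F hF).mp subset_rfl
    exact (hbij F' hF').2.injOn.mono (Finset.coe_subset.mpr hle)

theorem IsCoveringMap.card_image (hφ : IsCoveringMap K M φ) {F : Finset V} (hF : K.IsFace F) :
    (F.image φ).card = F.card :=
  Finset.card_image_of_injOn (hφ.injOn hF)

/-- Two faces over the same face that share a vertex agree. -/
theorem IsCoveringMap.eq_of_image_eq (hφ : IsCoveringMap K M φ) {F₁ F₂ : Finset V}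
    (h₁ : K.IsFace F₁) (h₂ : K.IsFace F₂) (h : F₁.image φ = F₂.image φ) {x : V}
    (hx₁ : x ∈ F₁) (hx₂ : x ∈ F₂) : F₁ = F₂ := by
  obtain ⟨𝓕, hdisj, hbij, hsub⟩ := hφ.preimage _ (hφ.simplicial F₁ h₁)
  -- A face that covers the whole base face fills the simplex of `𝓕` containing it, so it belongs to
  -- `𝓕`; disjointness then finishes.
  have key : ∀ F, K.IsFace F → x ∈ F → F.image φ = F₁.image φ → F ∈ 𝓕 := by
    intro F hF hx hFG
    obtain ⟨F', hF', hle⟩ :=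
      (hsub F (hF.resolve_left (Finset.ne_empty_of_mem hx))).mp hFG.subset
    suffices F' = F from this ▸ hF'
    refine (Finset.Subset.antisymm hle fun y hy => ?_).symm
    have hy' : φ y ∈ F.image φ := hFG ▸ Finset.mem_coe.mp ((hbij F' hF').2.mapsTo hy)
    obtain ⟨z, hz, hzy⟩ := Finset.mem_image.mp hy'
    rwa [← (hbij F' hF').2.injOn (hle hz) hy hzy]
  by_contra hne
  exact Finset.disjoint_left.mp (hdisj (key F₁ h₁ hx₁ rfl) (key F₂ h₂ hx₂ h.symm) hne) hx₁ hx₂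

theorem IsCoveringMap.inBoundary_image (hφ : IsCoveringMap K M φ) {F F' : Finset V}
    (hF' : K.IsFace F') (h : InBoundary F F') : InBoundary (F.image φ) (F'.image φ) :=
  ⟨Finset.image_subset_image h.1, by
    rw [hφ.card_image hF', hφ.card_image (hF'.mono h.1), h.2]⟩

theorem not_maximal_isFace_iff {F : Finset V} (hF : K.IsFace F) :
    ¬ Maximal K.IsFace F ↔ ∃ G, K.IsFace G ∧ InBoundary F G := by
  rw [not_maximal_iff hF]
  constructor
  · rintro ⟨G, hG, hlt⟩
    obtain ⟨x, hxG, hxF⟩ := Finset.exists_of_ssubset hlt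
    exact ⟨insert x F, hG.mono (Finset.insert_subset hxG hlt.1), Finset.subset_insert _ _,
      Finset.card_insert_of_notMem hxF⟩
  · rintro ⟨G, hG, hsub, hcard⟩
    refine ⟨G, hG, Finset.ssubset_iff_subset_ne.mpr ⟨hsub, ?_⟩⟩
    rintro rfl
    omega

/-- Non-maximality is witnessed by adding one vertex; such a witness lifts by strongness and
descends by taking images. -/
theorem IsStrongCovering.maximal_image_iff (hφ : IsStrongCovering K M φ) {F : Finset V}
    (hF : K.IsFace F) : Maximal M.IsFace (F.image φ) ↔ Maximal K.IsFace F := by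
  rw [← not_iff_not, not_maximal_isFace_iff hF, not_maximal_isFace_iff (hφ.simplicial F hF)]
  constructor
  · rintro ⟨G, hG, hb⟩
    obtain ⟨F', hF', hFF'⟩ := hφ.lift _ G (hφ.simplicial F hF) hG hb F ⟨hF, rfl⟩
    exact ⟨F', hF'.1, hFF'⟩
  · rintro ⟨G, hG, hb⟩
    exact ⟨_, hφ.simplicial G hG, hφ.toIsCoveringMap.inBoundary_image hG hb⟩

/-! ### The normalized weight -/

/-- Downward induction on dimension: the faces one vertex larger than `F` correspond bijectively to
those one vertex larger than its image. Strongness gives surjectivity. Injectivity needs a vertex of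
`F` for two such faces to share, hence `F` nonempty. -/
theorem IsStrongCovering.normalizedWeightFun_image [Fintype V] [Fintype W]
    (hφ : IsStrongCovering K M φ) {F : Finset V} (hF : K.IsFace F) (hne : F.Nonempty) :
    normalizedWeightFun M (F.image φ) = normalizedWeightFun K F := by
  classical
  induction hm : Fintype.card V - F.card using Nat.strong_induction_on generalizing F with
  | _ m ih =>
    by_cases hmax : Maximal K.IsFace F
    · rw [normalizedWeightFun, normalizedWeightFun, if_pos hmax,
        if_pos ((hφ.maximal_image_iff hF).mpr hmax)]
    · rw [normalizedWeightFun_of_not_maximal hmax,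
        normalizedWeightFun_of_not_maximal (mt (hφ.maximal_image_iff hF).mp hmax)]
      symm
      refine Finset.sum_nbij (fun G => G.image φ) ?_ ?_ ?_ ?_
      · intro G hG
        obtain ⟨-, hG, hb⟩ := Finset.mem_filter.mp hG
        exact Finset.mem_filter.mpr ⟨Finset.mem_univ _, hφ.simplicial G hG,
          hφ.toIsCoveringMap.inBoundary_image hG hb⟩
      · intro G hG G' hG' h
        obtain ⟨-, hG, hb⟩ := Finset.mem_filter.mp hG
        obtain ⟨-, hG', hb'⟩ := Finset.mem_filter.mp hG'
        obtain ⟨x, hx⟩ := hne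
        exact hφ.toIsCoveringMap.eq_of_image_eq hG hG' h (hb.1 hx) (hb'.1 hx)
      · intro G hG
        obtain ⟨-, hG, hb⟩ := Finset.mem_filter.mp hG
        obtain ⟨F', hF', hFF'⟩ := hφ.lift _ G (hφ.simplicial F hF) hG hb F ⟨hF, rfl⟩
        exact ⟨F', Finset.mem_coe.mpr (Finset.mem_filter.mpr ⟨Finset.mem_univ _, hF'.1, hFF'⟩),
          hF'.2⟩
      · intro G hG
        obtain ⟨-, hG, hb⟩ := Finset.mem_filter.mp hG
        have h1 := hb.2
        have h2 := Finset.card_le_univ G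
        exact (ih _ (by omega) hG (hne.mono hb.1) rfl).symm

theorem IsKFoldCovering.exists_isFace_image (hφ : IsKFoldCovering K M φ k) {G : Finset W}
    (hG : M.IsFace G) : ∃ F, K.IsFace F ∧ F.image φ = G := by
  rcases hG with rfl | hG
  · exact ⟨∅, Or.inl rfl, rfl⟩
  · exact Set.nonempty_of_ncard_ne_zero (hφ.degree G hG ▸ hφ.pos.ne')

theorem not_maximal_isFace_empty [Nonempty V] : ¬ Maximal K.IsFace ∅ := by
  obtain ⟨x⟩ := ‹Nonempty V›
  exact (not_maximal_isFace_iff (Or.inl rfl)).mpr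
    ⟨{x}, Or.inr (K.singleton_mem x), inBoundary_empty_iff.mpr (Finset.card_singleton x)⟩

/-- The weight of `∅` is the sum of the vertex weights, and each vertex of `M` has `k` preimages of
its own weight. If `W` were empty, `∅` would be a facet of weight `1` in both complexes. -/
theorem IsKFoldCovering.normalizedWeightFun_empty [Fintype V] [Fintype W] [Nonempty W]
    (hφ : IsKFoldCovering K M φ k) :
    normalizedWeightFun K ∅ = k * normalizedWeightFun M ∅ := by
  classical
  have y := Classical.arbitrary W
  have : Nonempty V := by
    obtain ⟨F, -, hFy⟩ := hφ.exists_isFace_image (Or.inr (M.singleton_mem y))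
    have hne : (F.image φ).Nonempty := hFy ▸ Finset.singleton_nonempty y
    exact (Finset.image_nonempty.mp hne).to_subtype.map Subtype.val
  rw [normalizedWeightFun_of_not_maximal not_maximal_isFace_empty,
    normalizedWeightFun_of_not_maximal not_maximal_isFace_empty, Finset.mul_sum,
    ← Finset.sum_fiberwise_of_maps_to (g := fun F => F.image φ)
      (t := Finset.univ.filter fun G => M.IsFace G ∧ InBoundary ∅ G)]
  · refine Finset.sum_congr rfl fun G hG => ?_
    obtain ⟨-, hG, hb⟩ := Finset.mem_filter.mp hG
    have hGne : G.Nonempty := Finset.card_pos.mp (by rw [inBoundary_empty_iff.mp hb]; exact one_pos)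
    -- The cardinality condition on the fibre is automatic, because `φ` preserves the size of faces.
    have hfib : (((Finset.univ.filter fun F => K.IsFace F ∧ InBoundary ∅ F).filter
        fun F => F.image φ = G : Finset (Finset V)) : Set (Finset V)) = facesOver K φ G := by
      ext F
      simp only [Finset.coe_filter, Finset.mem_filter, Finset.mem_univ, true_and, Set.mem_ofPred_eq,
        facesOver, inBoundary_empty_iff]
      refine ⟨fun h => ⟨h.1.1, h.2⟩, fun h => ⟨⟨h.1, ?_⟩, h.2⟩⟩
      rw [← hφ.toIsCoveringMap.card_image h.1, h.2, inBoundary_empty_iff.mp hb]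
    rw [Finset.sum_congr rfl (g := fun _ => normalizedWeightFun M G), Finset.sum_const,
      ← Set.ncard_coe_finset, hfib, hφ.degree G (hG.resolve_left hGne.ne_empty), nsmul_eq_mul]
    intro F hF
    obtain ⟨hmem, rfl⟩ := Finset.mem_filter.mp hF
    obtain ⟨-, hface, -⟩ := Finset.mem_filter.mp hmem
    exact (hφ.toIsStrongCovering.normalizedWeightFun_image hface (Finset.image_nonempty.mp hGne)).symm
  · intro F hF
    obtain ⟨-, hF, hb⟩ := Finset.mem_filter.mp hF
    refine Finset.mem_filter.mpr ⟨Finset.mem_univ _, hφ.simplicial F hF, ?_⟩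
    rw [inBoundary_empty_iff] at hb ⊢
    rw [hφ.toIsCoveringMap.card_image hF, hb]

/-! ### Lifts of ordered faces -/

/-- The image of an ordered face. -/
def OrderedFace.map (hφ : IsCoveringMap K M φ) (u : K.OrderedFace n) : M.OrderedFace n :=
  ⟨⟨fun a => φ (u.1 a), fun a b h => u.1.injective
      (hφ.injOn u.2 (u.apply_mem_vertices a) (u.apply_mem_vertices b) h)⟩,
    (hφ.simplicial _ u.2).mono (by
      intro x hx
      obtain ⟨a, -, rfl⟩ := Finset.mem_map.mp hx
      exact Finset.mem_image_of_mem φ (u.apply_mem_vertices a))⟩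

theorem OrderedFace.vertices_map (hφ : IsCoveringMap K M φ) (u : K.OrderedFace n) :
    (u.map hφ).vertices = u.vertices.image φ := by
  ext x
  simp only [Finset.mem_image, OrderedFace.mem_vertices, exists_exists_eq_and]
  rfl

/-- Over the ordered face `v`, a face has a unique compatible ordering of its vertices. -/
theorem IsCoveringMap.exists_ordered_lift (hφ : IsCoveringMap K M φ) (v : M.OrderedFace n)
    {F : Finset V} (hF : K.IsFace F) (h : F.image φ = v.vertices) :
    ∃ u : K.OrderedFace n, u.vertices = F ∧ u.map hφ = v := by
  have hex (a : Fin n) : ∃ x ∈ F, φ x = v.1 a :=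
    Finset.mem_image.mp (h ▸ v.apply_mem_vertices a)
  choose s hs hsv using hex
  have hinj : Function.Injective s := fun a b hab =>
    v.1.injective (by rw [← hsv a, ← hsv b, hab])
  have hsub : Finset.univ.map ⟨s, hinj⟩ ⊆ F := by
    intro x hx
    obtain ⟨a, -, rfl⟩ := Finset.mem_map.mp hx
    exact hs a
  refine ⟨⟨⟨s, hinj⟩, hF.mono hsub⟩, Finset.eq_of_subset_of_card_le hsub ?_,
    OrderedFace.ext hsv⟩
  rw [← hφ.card_image hF, h, OrderedFace.card_vertices]
  exact (OrderedFace.card_vertices _).ge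

/-- A lift of an ordered face is determined by its vertices. -/
theorem IsCoveringMap.ordered_lift_unique (hφ : IsCoveringMap K M φ) {u u' : K.OrderedFace n}
    (hvert : u.vertices = u'.vertices) (h : u.map hφ = u'.map hφ) : u = u' :=
  OrderedFace.ext fun a => hφ.injOn u.2 (u.apply_mem_vertices a)
    (Finset.mem_coe.mpr (hvert ▸ u'.apply_mem_vertices a) : u'.1 a ∈ (u.vertices : Set V))
    (DFunLike.congr_fun (congrArg Subtype.val h) a)

theorem IsKFoldCovering.exists_map_eq (hφ : IsKFoldCovering K M φ k) (v : M.OrderedFace n) :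
    ∃ u : K.OrderedFace n, u.map hφ.toIsCoveringMap = v := by
  obtain ⟨F, hF, h⟩ := hφ.exists_isFace_image v.isFace_vertices
  obtain ⟨u, -, hu⟩ := hφ.toIsCoveringMap.exists_ordered_lift v hF h
  exact ⟨u, hu⟩

open Classical in
/-- The lifts of an ordered face. -/
def lifts [Finite V] (hφ : IsCoveringMap K M φ) (v : M.OrderedFace n) :
    Finset (K.OrderedFace n) :=
  Finset.univ.filter fun u => u.map hφ = v

theorem mem_lifts [Finite V] {hφ : IsCoveringMap K M φ} {v : M.OrderedFace n}
    {u : K.OrderedFace n} : u ∈ lifts hφ v ↔ u.map hφ = v := by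
  simp [lifts]

/-- Each face over the vertex set of `v` carries exactly one ordering compatible with `v`, so
ordered lifts are counted by `degree`. The index `n + 1` excludes the empty face. -/
theorem IsKFoldCovering.card_lifts [Finite V] (hφ : IsKFoldCovering K M φ k)
    (v : M.OrderedFace (n + 1)) : (lifts hφ.toIsCoveringMap v).card = k := by
  have hv : v.vertices ∈ M := v.isFace_vertices.resolve_left
    (Finset.ne_empty_of_mem (v.apply_mem_vertices 0))
  refine Eq.trans ?_ (hφ.degree _ hv)
  rw [← Set.ncard_coe_finset]
  refine Set.BijOn.ncard_eq (f := OrderedFace.vertices) ⟨fun u hu => ?_, ?_, ?_⟩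
  · have hu := mem_lifts.mp hu
    exact ⟨u.isFace_vertices, by rw [← OrderedFace.vertices_map hφ.toIsCoveringMap, hu]⟩
  · intro u hu u' hu' h
    exact hφ.toIsCoveringMap.ordered_lift_unique h
      ((mem_lifts.mp hu).trans (mem_lifts.mp hu').symm)
  · rintro F ⟨hF, h⟩
    obtain ⟨u, hu, hum⟩ := hφ.toIsCoveringMap.exists_ordered_lift v hF h
    exact ⟨u, mem_lifts.mpr hum, hu⟩

/-- Removing a vertex maps the lifts of an ordered face bijectively onto the lifts of its
nonempty boundary face. -/
theorem IsStrongCovering.sum_lifts_dropVertex [Finite V] (hφ : IsStrongCovering K M φ)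
    (v : M.OrderedFace (n + 2)) (j : Fin (n + 2)) (h : K.OrderedFace (n + 1) → ℝ) :
    ∑ u ∈ lifts hφ.toIsCoveringMap v, h (u.dropVertex j) =
      ∑ u ∈ lifts hφ.toIsCoveringMap (v.dropVertex j), h u := by
  refine Finset.sum_nbij (fun u => u.dropVertex j) ?_ ?_ ?_ fun _ _ => rfl
  · intro u hu
    rw [mem_lifts] at hu ⊢
    rw [← hu]
    rfl
  · intro u hu u' hu' huu'
    have hu := mem_lifts.mp hu
    have hu' := mem_lifts.mp hu'
    refine hφ.toIsCoveringMap.ordered_lift_unique ?_ (hu.trans hu'.symm)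
    -- The common boundary face has `n + 1` vertices, so its vertex at position `0` is shared by
    -- both lifts.
    refine hφ.toIsCoveringMap.eq_of_image_eq u.isFace_vertices u'.isFace_vertices
      (x := (u.dropVertex j).1 0) ?_ ?_ ?_
    · rw [← OrderedFace.vertices_map hφ.toIsCoveringMap, hu, ← hu', OrderedFace.vertices_map]
    · exact u.apply_mem_vertices _
    · have huu' : u.dropVertex j = u'.dropVertex j := huu'
      rw [huu']
      exact u'.apply_mem_vertices _
  · intro u hu
    have hu := mem_lifts.mp hu
    obtain ⟨F, ⟨hF, hFv⟩, hb⟩ := hφ.lift (v.dropVertex j).vertices v.vertices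
      (v.dropVertex j).isFace_vertices v.isFace_vertices (v.inBoundary_dropVertex j) u.vertices
      ⟨u.isFace_vertices, by rw [← OrderedFace.vertices_map hφ.toIsCoveringMap, hu]⟩
    obtain ⟨u', hu'F, hu'⟩ := hφ.toIsCoveringMap.exists_ordered_lift v hF hFv
    refine ⟨u', mem_lifts.mpr hu', ?_⟩
    ext a
    -- Both vertices lie in `F` and have the same image, so they coincide.
    refine hφ.toIsCoveringMap.injOn hF ?_ (hb.1 (u.apply_mem_vertices a)) ?_
    · rw [← hu'F]
      exact u'.apply_mem_vertices _
    · have h1 : (u'.dropVertex j).map hφ.toIsCoveringMap = u.map hφ.toIsCoveringMap := by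
        rw [hu, ← hu']
        rfl
      exact DFunLike.congr_fun (congrArg Subtype.val h1) a

/-! ### Pullback and pushforward of cochains -/

/-- The pullback of cochains. -/
def pullback (hφ : IsCoveringMap K M φ) (wK : K.FaceWeight) (wM : M.FaceWeight) (n : ℕ) :
    WCochain wM n →ₗ[ℝ] WCochain wK n where
  toFun g := ⟨fun u => g.1 (u.map hφ), fun u σ => g.2 (u.map hφ) σ⟩
  map_add' _ _ := rfl
  map_smul' _ _ := rfl

/-- The pushforward of cochains: sum over all lifts. -/
def pushforward [Finite V] (hφ : IsCoveringMap K M φ) (wK : K.FaceWeight) (wM : M.FaceWeight)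
    (n : ℕ) (h : WCochain wK n) : WCochain wM n :=
  ⟨fun v => ∑ u ∈ lifts hφ v, h.1 u, fun v σ => by
    rw [Finset.mul_sum]
    symm
    refine Finset.sum_equiv (OrderedFace.permEquiv σ) (fun u => ?_) fun u _ => (h.2 u σ).symm
    rw [mem_lifts, mem_lifts]
    exact (OrderedFace.permEquiv σ).apply_eq_iff_eq.symm⟩

theorem IsKFoldCovering.pullback_injective (hφ : IsKFoldCovering K M φ k) (wK : K.FaceWeight)
    (wM : M.FaceWeight) (n : ℕ) :
    Function.Injective (pullback hφ.toIsCoveringMap wK wM n) := by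
  intro f g h
  apply Subtype.ext
  funext v
  obtain ⟨u, rfl⟩ := hφ.exists_map_eq v
  exact congrFun (congrArg Subtype.val h) u

/-- Up to `c`, pullback and pushforward are adjoint: group the ordered faces of `K` by their images;
on each group the pulled-back cochain and the weight are constant. -/
theorem inner_pullback [Finite V] [Finite W] (hφ : IsCoveringMap K M φ)
    {wK : K.FaceWeight} {wM : M.FaceWeight} {c : ℝ}
    (hw : ∀ F, K.IsFace F → F.card = n → wK.toFun F = c * wM.toFun (F.image φ))
    (g : WCochain wM n) (h : WCochain wK n) :
    inner ℝ (pullback hφ wK wM n g) h = c * inner ℝ g (pushforward hφ wK wM n h) := by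
  classical
  refine mul_left_cancel₀ (Nat.cast_ne_zero (R := ℝ).mpr n.factorial_ne_zero) ?_
  rw [mul_left_comm, factorial_mul_inner, factorial_mul_inner, Finset.mul_sum,
    ← Finset.sum_fiberwise (s := Finset.univ) (g := fun u : K.OrderedFace n => u.map hφ)]
  refine Finset.sum_congr rfl fun v _ => ?_
  change _ = c * (wM.toFun v.vertices * g.1 v * ∑ u ∈ lifts hφ v, h.1 u)
  rw [Finset.mul_sum, Finset.mul_sum]
  refine Finset.sum_congr (by ext; simp [lifts]) fun u hu => ?_
  have hu := mem_lifts.mp hu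
  rw [hw _ u.isFace_vertices u.card_vertices, ← OrderedFace.vertices_map hφ, hu]
  change _ * g.1 (u.map hφ) * _ = _
  rw [hu]
  ring

theorem IsStrongCovering.pushforward_wCoboundary [Finite V] [Finite W]
    (hφ : IsStrongCovering K M φ) (wK : K.FaceWeight) (wM : M.FaceWeight)
    (h : WCochain wK (n + 1)) :
    pushforward hφ.toIsCoveringMap wK wM (n + 2) (wCoboundary wK (n + 1) h) =
      wCoboundary wM (n + 1) (pushforward hφ.toIsCoveringMap wK wM (n + 1) h) := by
  apply Subtype.ext
  funext v
  change ∑ u ∈ lifts hφ.toIsCoveringMap v, ∑ j : Fin (n + 2), (-1 : ℝ) ^ (j : ℕ) * h.1 (u.dropVertex j) =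
    ∑ j : Fin (n + 2), (-1 : ℝ) ^ (j : ℕ) * ∑ u ∈ lifts hφ.toIsCoveringMap (v.dropVertex j), h.1 u
  rw [Finset.sum_comm]
  refine Finset.sum_congr rfl fun j _ => ?_
  rw [← Finset.mul_sum, hφ.sum_lifts_dropVertex v j]

/-- All `k` lifts of a vertex have the same boundary, the only empty face of `K`, so its value is
counted `k` times. -/
theorem IsKFoldCovering.pushforward_wCoboundary_zero [Finite V] [Finite W]
    (hφ : IsKFoldCovering K M φ k) (wK : K.FaceWeight) (wM : M.FaceWeight)
    (h : WCochain wK 0) :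
    pushforward hφ.toIsCoveringMap wK wM 1 (wCoboundary wK 0 h) =
      (k : ℝ) • wCoboundary wM 0 (pushforward hφ.toIsCoveringMap wK wM 0 h) := by
  apply Subtype.ext
  funext v
  change ∑ u ∈ lifts hφ.toIsCoveringMap v, ∑ j : Fin 1, (-1 : ℝ) ^ (j : ℕ) * h.1 (u.dropVertex j) =
    k * ∑ j : Fin 1, (-1 : ℝ) ^ (j : ℕ) *
      ∑ u ∈ lifts hφ.toIsCoveringMap (v.dropVertex j), h.1 u
  have hsub (u u' : K.OrderedFace 0) : u = u' := OrderedFace.ext fun a => a.elim0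
  obtain ⟨u₀, hu₀⟩ := hφ.exists_map_eq (v.dropVertex 0)
  have hl : lifts hφ.toIsCoveringMap (v.dropVertex 0) = {u₀} :=
    Finset.eq_singleton_iff_unique_mem.mpr ⟨mem_lifts.mpr hu₀, fun u _ => hsub u u₀⟩
  simp only [Fin.sum_univ_one, hl, Finset.sum_singleton]
  rw [Finset.sum_congr rfl fun u _ => by rw [hsub (u.dropVertex 0) u₀], Finset.sum_const,
    hφ.card_lifts, nsmul_eq_mul]

/-- The pullback intertwines the down Laplace operators, for compatible weights. -/
theorem downLaplacian_comp_pullback [Finite V] [Finite W] (hφ : IsCoveringMap K M φ)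
    {wK : K.FaceWeight} {wM : M.FaceWeight} {i : ℕ} {c : ℝ}
    (hw : ∀ F, K.IsFace F → F.card = i → wK.toFun F = c * wM.toFun (F.image φ))
    (hw' : ∀ F, K.IsFace F → F.card = i + 1 → wK.toFun F = wM.toFun (F.image φ))
    (hpush : ∀ h, pushforward hφ wK wM (i + 1) (wCoboundary wK i h) =
      c • wCoboundary wM i (pushforward hφ wK wM i h)) :
    downLaplacian wK i ∘ₗ pullback hφ wK wM (i + 1) =
      pullback hφ wK wM (i + 1) ∘ₗ downLaplacian wM i := by
  have hadj (g : WCochain wM (i + 1)) :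
      LinearMap.adjoint (wCoboundary wK i) (pullback hφ wK wM (i + 1) g) =
        pullback hφ wK wM i (LinearMap.adjoint (wCoboundary wM i) g) := by
    -- Pairing with `h` turns the claim into `hpush`; its factor `c` is the one by which the weights
    -- in the lower degree differ.
    refine ext_inner_right ℝ fun h => ?_
    rw [LinearMap.adjoint_inner_left,
      inner_pullback hφ (c := 1) (fun F hF hc => (hw' F hF hc).trans (one_mul _).symm), one_mul,
      hpush, inner_smul_right, ← LinearMap.adjoint_inner_left, inner_pullback hφ hw]
  ext1 g
  change wCoboundary wK i (LinearMap.adjoint (wCoboundary wK i) _) = _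
  rw [hadj]
  -- Deleting a vertex commutes with applying `φ`, so pullback and coboundary commute by definition.
  rfl

end Covering

end

end AbstractSimplicialComplex

/-! ### The spectral inclusions -/

open AbstractSimplicialComplex in
theorem mainTheorem6 {V W : Type*} [Fintype V] [DecidableEq V] [Fintype W] [DecidableEq W]
    (K : AbstractSimplicialComplex V) (M : AbstractSimplicialComplex W) (φ : V → W) (k : ℕ)
    (hφ : AbstractSimplicialComplex.IsKFoldCovering K M φ k) :
    (∀ i : ℕ, 1 ≤ i →
      AbstractSimplicialComplex.multisetSpectrum (M.combDownLaplacian i) ≤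
        AbstractSimplicialComplex.multisetSpectrum (K.combDownLaplacian i)) ∧
    (∀ i : ℕ,
      AbstractSimplicialComplex.multisetSpectrum (M.normDownLaplacian i) ≤
        AbstractSimplicialComplex.multisetSpectrum (K.normDownLaplacian i)) := by
  have hnorm (n : ℕ) (F : Finset V) (hF : K.IsFace F) (hc : F.card = n + 1) :
      (normalizedWeight K).toFun F = (normalizedWeight M).toFun (F.image φ) :=
    (hφ.toIsStrongCovering.normalizedWeightFun_image hF
      (Finset.card_pos.mp (hc ▸ n.succ_pos))).symm
  refine ⟨fun i hi => ?_, fun i => ?_⟩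
  -- With `i = n + 1` the boundary faces are nonempty, so the pushforward commutes with `δ` without
  -- a factor.
  · obtain ⟨n, rfl⟩ := Nat.exists_eq_add_of_le' hi
    refine multisetSpectrum_le_of_intertwine _ _ _ (hφ.pullback_injective _ _ _)
      (downLaplacian_comp_pullback hφ.toIsCoveringMap (c := 1) (fun F _ _ => (one_mul _).symm)
        (fun F _ _ => rfl) fun h => ?_)
    rw [one_smul]
    exact hφ.toIsStrongCovering.pushforward_wCoboundary _ _ h
  · refine multisetSpectrum_le_of_intertwine _ _ _
      (hφ.pullback_injective (normalizedWeight K) (normalizedWeight M) _) ?_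
    -- With `W` empty the weight formula for `∅` is unavailable, but there are no faces with `i + 1`
    -- vertices, so the identity is vacuous.
    rcases isEmpty_or_nonempty W with hW | hW
    · ext1 g
      apply Subtype.ext
      funext v
      exact (hW.false (φ (v.1 0))).elim
    · rcases i with _ | n
      -- The boundary is the empty face: the factor `k` in the pushforward matches the ratio of the
      -- weights of `∅`.
      · refine downLaplacian_comp_pullback hφ.toIsCoveringMap (c := k) (fun F _ hc => ?_)
          (hnorm 0) (hφ.pushforward_wCoboundary_zero _ _)
        obtain rfl := Finset.card_eq_zero.mp hc
        exact hφ.normalizedWeightFun_empty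
      · refine downLaplacian_comp_pullback hφ.toIsCoveringMap (c := 1)
          (fun F hF hc => (hnorm n F hF hc).trans (one_mul _).symm) (hnorm (n + 1)) fun h => ?_
        rw [one_smul]
        exact hφ.toIsStrongCovering.pushforward_wCoboundary _ _ h
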